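/- Lemma (Restricted isometry property on unions of subspaces). There is an absolute constant $C>0$ such that the following holds. Let $\mathbb K\in\{\mathbb R,\mathbb C\}$, let $n,\ell,M\ge 1$ and $m\ge 0$ be integers, and let $F\in\mathbb K^{n\times n}$ be unitary. Let $\mathcal T\subseteq\mathbb K^n$ be either a union of at most $M$ $\mathbb K$-linear subspaces of $\mathbb K^n$, each of dimension at most $\ell$ over $\mathbb K$, or a union of at most $M$ linear subspaces of $\mathbb R^n$, each of real dimension at most $\ell$, embedded canonically into $\mathbb K^n$ (so that a complex $F$ may act on real subspaces). Let $\boldsymbol\alpha$ be the vector of local coherences of $F$ with respect to $\mathcal T$, $$\alpha_j=\sup\{|(Fx)_j| : x\in\mathcal T,\ \|x\|_2\le 1\},\qquad j=1,\dots,n,$$ let $\boldsymbol p\in(0,1]^n$ with $\sum_j p_j=1$, let $\mu(\boldsymbol\alpha,\boldsymbol p)=\max_j \alpha_j/\sqrt{p_j}$, and let $D=\mathrm{Diag}(\boldsymbol d)$ with $d_i=(np_i)^{-1/2}$. Let $S\in\mathbb R^{m\times n}$ be a with-replacement sampling matrix associated with $\boldsymbol p$, i.e. a random matrix with independent rows $\boldsymbol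 s_1,\dots,\boldsymbol s_m$ such that $\mathbb P\big(\boldsymbol s_i=\sqrt{n/m}\,\boldsymbol e_j\big)=p_j$ for all $i,j$. Let $t>0$. If $$m\ \ge\ C\,\mu^2(\boldsymbol\alpha,\boldsymbol p)\,\big(\log\ell+\log M+t^2\big),$$ then with probability at least $1-2e^{-t^2}$ the matrix $SDF$ satisfies the restricted isometry property on $\mathcal T$: $$\sup_{u\in\mathcal T,\ \|u\|_2=1}\big|\,\|SDFu\|_2-1\,\big|\le \tfrac13 .$$ -/

import Mathlib

open MeasureTheory ProbabilityTheory

noncomputable section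

/-- `T` is a union of at most `M` linear subspaces (over `𝕜`), each of dimension at most `ℓ`. -/
def IsUnionOfSubspaces (𝕜 : Type*) {V : Type*} [Field 𝕜] [AddCommGroup V] [Module 𝕜 V]
    (M ℓ : ℕ) (T : Set V) : Prop :=
  ∃ 𝒰 : Finset (Submodule 𝕜 V), 𝒰.card ≤ M ∧ (∀ U ∈ 𝒰, Module.finrank 𝕜 U ≤ ℓ) ∧
    T = ⋃ U ∈ 𝒰, (U : Set V)

/-- The canonical embedding of `ℝⁿ` into `𝕜ⁿ` (for `𝕜 = ℝ` or `𝕜 = ℂ`). -/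
def realEmbed (𝕜 : Type*) [RCLike 𝕜] {n : ℕ} (x : EuclideanSpace ℝ (Fin n)) :
    EuclideanSpace 𝕜 (Fin n) :=
  WithLp.toLp 2 (fun i => ((x i : ℝ) : 𝕜))

/-- The local coherence of a vector `φ` with respect to a set `T`: the supremum of `|φ* x|` over
the `x ∈ T` in the closed Euclidean unit ball. The set of these numbers is bounded by `‖φ‖`. -/
def localCoherence {𝕜 : Type*} [RCLike 𝕜] {n : ℕ} (T : Set (EuclideanSpace 𝕜 (Fin n)))
    (φ : EuclideanSpace 𝕜 (Fin n)) : ℝ :=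
  sSup ((fun x : EuclideanSpace 𝕜 (Fin n) => ‖inner 𝕜 φ x‖) '' (T ∩ Metric.closedBall 0 1))

/-- The column vector `f_j` for which `f_j*` is the `j`-th row of `F`, so that
`f_j* x = (F x)_j`. -/
def rowVector {𝕜 : Type*} [RCLike 𝕜] {n : ℕ} (F : Matrix (Fin n) (Fin n) 𝕜) (j : Fin n) :
    EuclideanSpace 𝕜 (Fin n) :=
  WithLp.toLp 2 (fun k => star (F j k))

/-- The vector of local coherences of the matrix `F` with respect to `T`. -/
def localCoherences {𝕜 : Type*} [RCLike 𝕜] {n : ℕ} (F : Matrix (Fin n) (Fin n) 𝕜)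
    (T : Set (EuclideanSpace 𝕜 (Fin n))) (j : Fin n) : ℝ :=
  localCoherence T (rowVector F j)

/-- The sampling complexity function `μ(α, p) = max_j α_j / √p_j`. -/
def samplingComplexity {n : ℕ} (α p : Fin n → ℝ) : ℝ :=
  ⨆ j, α j / Real.sqrt (p j)

/-- The random matrix `S` is a with-replacement sampling matrix for the probabilities `p`:
its rows are independent random vectors, and each of them equals `√(n/m) e_j` with
probability `p_j`. -/
structure IsWithReplacementSampling {Ω : Type*} [MeasurableSpace Ω] (P : Measure Ω) {m n : ℕ}
    (p : Fin n → ℝ) (S : Ω → Matrix (Fin m) (Fin n) ℝ) : Prop where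
  measurable_row : ∀ i, Measurable (fun ω => (S ω i : Fin n → ℝ))
  indep_rows : iIndepFun (fun (i : Fin m) (ω : Ω) => (S ω i : Fin n → ℝ)) P
  prob_row : ∀ i j, P.real {ω | S ω i = Pi.single j (Real.sqrt ((n : ℝ) / m))} = p j

/-- The restricted isometry property of `A` on `T`: the supremum of `|‖A u‖ - 1|` over the unit
vectors `u ∈ T` is at most `1/3`. -/
def HasRIP {𝕜 : Type*} [RCLike 𝕜] {m n : ℕ} (A : Matrix (Fin m) (Fin n) 𝕜)
    (T : Set (EuclideanSpace 𝕜 (Fin n))) : Prop :=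
  ∀ u ∈ T, ‖u‖ = 1 → |‖Matrix.toEuclideanLin A u‖ - 1| ≤ 1 / 3

/-- The preconditioned matrix `S D F` with `D = Diag((n p_i)^(-1/2))`, where the real matrices
`S` and `D` are read as matrices over `𝕜`. -/
def preconditioned {𝕜 : Type*} [RCLike 𝕜] {m n : ℕ} (S : Matrix (Fin m) (Fin n) ℝ)
    (p : Fin n → ℝ) (F : Matrix (Fin n) (Fin n) 𝕜) : Matrix (Fin m) (Fin n) 𝕜 :=
  (S * Matrix.diagonal (fun i => (Real.sqrt (n * p i))⁻¹)).map (fun x : ℝ => (x : 𝕜)) * F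

end

/-! By a union bound it suffices to treat one subspace `U` at a time. On `U`, `‖SDFu‖²` is the mean
of `m` independent samples of the forms `|(Fu)_j|²/p_j`. These average to `‖u‖²` because `F` is
unitary, and are at most `μ²‖u‖²` by definition of the coherences. A matrix Chernoff bound
(`sum_prod_filter_deviation_le`) controls the deviation uniformly on the unit sphere of `U`. It is
proved over `ℝ`: this covers real subspaces under a complex `F`, and at most doubles the dimension
of `𝕜`-subspaces.

The Chernoff bound uses the trace of the exponential, but neither Golden–Thompson nor Lieb. Instead
`sum_exp_perturbation_le` bounds the trace of `e^(A+sX)` by that of `e^A` plus `s+4R` times the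
trace of `e^A X`, when `s = ±1` and `X² ≤ RX`. On average each sample then multiplies the trace by
at most `exp((s+4R)θ)`, and Markov's inequality finishes. Concentration is a statement about finite
sums over index tuples `J` with weights `∏ p (J i)`; `sum_prod_le_measureReal` transfers it to `P`.
-/

/-- After moving the `c`-terms to the left, both `e^x - 1 - x` and `2c·x(e^x - 1)` are at most
`x(e^x - 1) ≤ (1 + e^x)x²`. -/
theorem exp_sub_one_sub_le (x c : ℝ) (hc : |c| ≤ 1 / 2) :
    Real.exp x - 1 - (1 + 4 * c) * x ≤ 2 * (1 + Real.exp x) * (x ^ 2 - c * x) := by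
  have h2 : 0 ≤ x * (Real.exp x - 1) := by
    rcases le_total 0 x with h | h
    · exact mul_nonneg h (by linarith [Real.add_one_le_exp x])
    · exact mul_nonneg_of_nonpos_of_nonpos h (by linarith [Real.exp_le_one_iff.2 h])
  have e1 := Real.add_one_le_exp x
  have e2 : Real.exp x * (1 - x) ≤ 1 := by
    have h' : Real.exp x * (-x + 1) ≤ Real.exp x * Real.exp (-x) := by
      gcongr
      exact Real.add_one_le_exp (-x)
    rw [← Real.exp_add] at h'
    simp at h'
    linarith
  have h3 : x * (Real.exp x - 1) ≤ (1 + Real.exp x) * x ^ 2 := by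
    have e3 := Real.exp_pos x
    rcases le_total 0 x with h | h
    · nlinarith [mul_nonneg h (sub_nonneg.2 e2), sq_nonneg x]
    · nlinarith [mul_nonneg (neg_nonneg.2 h) (sub_nonneg.2 e1), mul_nonneg e3.le (sq_nonneg x)]
  have h4 : c * (x * (Real.exp x - 1)) ≤ 1 / 2 * (x * (Real.exp x - 1)) :=
    mul_le_mul_of_nonneg_right ((le_abs_self c).trans hc) h2
  nlinarith

/-! ### Perturbation of the exponential trace -/

section Trace

variable {E : Type*} [NormedAddCommGroup E] [InnerProductSpace ℝ E]

/-- The weights `q_ij = ⟨u_i, w_j⟩²` are doubly stochastic, and `sX` has entries `(b_i - a_j)⟨u_i,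
w_j⟩` between the two eigenbases. So the `q`-weighted first and second moments of `x = b_i - a_j`
are `s⟨Xv, v⟩` and `‖Xv‖²`, with `v = u_i` or `w_j`. By `hXR` the weighted sum of `x² - sRx` is
nonpositive along every row and column. The error in `exp_sub_one_sub_le` with `c = sR`, times
`e^(a_j)`, splits into a part weighted by `e^(b_i)` (sum over `j` first) and one by `e^(a_j)` (sum
over `i` first). -/
theorem sum_exp_perturbation_le {ι : Type*} [Fintype ι] {A X : E →ₗ[ℝ] E} {s R : ℝ}
    (hX : X.IsSymmetric) (hs : s ^ 2 = 1)
    (hR : |R| ≤ 1 / 2) (hXR : ∀ u, ‖X u‖ ^ 2 ≤ R * inner ℝ (X u) u)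
    (w u : OrthonormalBasis ι ℝ E) (a b : ι → ℝ)
    (hw : ∀ j, A (w j) = a j • w j) (hu : ∀ i, (A + s • X) (u i) = b i • u i)
    (hA : A.IsSymmetric) :
    ∑ i, Real.exp (b i) ≤ ∑ j, Real.exp (a j) +
      (s + 4 * R) * ∑ j, Real.exp (a j) * inner ℝ (X (w j)) (w j) := by
  have hc (i j) : s * inner ℝ (X (u i)) (w j) = (b i - a j) * inner ℝ (u i) (w j) := by
    have h1 : inner ℝ ((A + s • X) (u i)) (w j) = b i * inner ℝ (u i) (w j) := by
      rw [hu, real_inner_smul_left]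
    have h2 : inner ℝ (A (u i)) (w j) = a j * inner ℝ (u i) (w j) := by
      rw [hA, hw, real_inner_smul_right]
    rw [LinearMap.add_apply, LinearMap.smul_apply, inner_add_left, real_inner_smul_left, h2] at h1
    linarith
  have hss : s * s = 1 := by rw [← sq]; exact hs
  have hc' (i j) : inner ℝ (X (u i)) (w j) = s * ((b i - a j) * inner ℝ (u i) (w j)) := by
    rw [← hc, ← mul_assoc, hss, one_mul]
  have r1 (i) : ∑ j, inner ℝ (u i) (w j) ^ 2 = 1 := by
    have := w.sum_sq_inner_left (u i)
    simpa using this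
  have r2 (j) : ∑ i, inner ℝ (u i) (w j) ^ 2 = 1 := by
    have := u.sum_sq_inner_right (w j)
    simpa using this
  have q1 (i) : inner ℝ (X (u i)) (u i) = s * ∑ j, inner ℝ (u i) (w j) ^ 2 * (b i - a j) := by
    rw [← w.sum_inner_mul_inner, Finset.mul_sum]
    refine Finset.sum_congr rfl fun j _ => ?_
    rw [hc', real_inner_comm (u i) (w j)]; ring
  have q2 (j) : inner ℝ (X (w j)) (w j) = s * ∑ i, inner ℝ (u i) (w j) ^ 2 * (b i - a j) := by
    rw [← u.sum_inner_mul_inner, Finset.mul_sum]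
    refine Finset.sum_congr rfl fun i _ => ?_
    rw [hX, real_inner_comm, hc']; ring
  have n1 (i) : ‖X (u i)‖ ^ 2 = ∑ j, inner ℝ (u i) (w j) ^ 2 * (b i - a j) ^ 2 := by
    rw [← w.sum_sq_inner_left]
    refine Finset.sum_congr rfl fun j _ => ?_
    rw [hc', mul_pow, hs]; ring
  have n2 (j) : ‖X (w j)‖ ^ 2 = ∑ i, inner ℝ (u i) (w j) ^ 2 * (b i - a j) ^ 2 := by
    rw [← u.sum_sq_inner_right]
    refine Finset.sum_congr rfl fun i _ => ?_
    rw [← hX, hc', mul_pow, hs]; ring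
  have k1 (i) : ∑ j, inner ℝ (u i) (w j) ^ 2 * ((b i - a j) ^ 2 - s * R * (b i - a j)) ≤ 0 := by
    have := hXR (u i)
    rw [n1, q1] at this
    rw [Finset.mul_sum, Finset.mul_sum, ← sub_nonpos, ← Finset.sum_sub_distrib] at this
    exact (Finset.sum_congr rfl fun _ _ => by ring).trans_le this
  have k2 (j) : ∑ i, inner ℝ (u i) (w j) ^ 2 * ((b i - a j) ^ 2 - s * R * (b i - a j)) ≤ 0 := by
    have := hXR (w j)
    rw [n2, q2] at this
    rw [Finset.mul_sum, Finset.mul_sum, ← sub_nonpos, ← Finset.sum_sub_distrib] at this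
    exact (Finset.sum_congr rfl fun _ _ => by ring).trans_le this
  have hsR : |s * R| ≤ 1 / 2 := by
    rwa [abs_mul, show |s| = 1 by rcases sq_eq_one_iff.1 hs with rfl | rfl <;> simp, one_mul]
  have term (i j) : inner ℝ (u i) (w j) ^ 2 * Real.exp (b i) ≤
      Real.exp (a j) * inner ℝ (u i) (w j) ^ 2
      + (1 + 4 * (s * R)) * (Real.exp (a j) * (inner ℝ (u i) (w j) ^ 2 * (b i - a j)))
      + 2 * (Real.exp (a j) * (inner ℝ (u i) (w j) ^ 2 * ((b i - a j) ^ 2 - s * R * (b i - a j))))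
      + 2 * (Real.exp (b i) * (inner ℝ (u i) (w j) ^ 2 * ((b i - a j) ^ 2 - s * R * (b i - a j)))) := by
    have h := exp_sub_one_sub_le (b i - a j) (s * R) hsR
    have h2 := mul_le_mul_of_nonneg_left h
      (mul_nonneg (Real.exp_pos (a j)).le (sq_nonneg (inner ℝ (u i) (w j))))
    have h3 : Real.exp (b i) = Real.exp (a j) * Real.exp (b i - a j) := by
      rw [← Real.exp_add]; congr 1; ring
    rw [h3]
    linarith
  have hsum := Finset.sum_le_sum fun i (_ : i ∈ Finset.univ) =>
    Finset.sum_le_sum fun j (_ : j ∈ Finset.univ) => term i j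
  simp only [Finset.sum_add_distrib, ← Finset.mul_sum (Finset.univ : Finset ι) _ (2 : ℝ)] at hsum
  have z0 : ∑ i, ∑ j, inner ℝ (u i) (w j) ^ 2 * Real.exp (b i) = ∑ i, Real.exp (b i) := by
    simp only [← Finset.sum_mul, r1, one_mul]
  have z1 : ∑ i, ∑ j, Real.exp (a j) * inner ℝ (u i) (w j) ^ 2 = ∑ j, Real.exp (a j) := by
    rw [Finset.sum_comm]
    simp only [← Finset.mul_sum, r2, mul_one]
  have z2 : ∑ i, ∑ j, (1 + 4 * (s * R)) *
      (Real.exp (a j) * (inner ℝ (u i) (w j) ^ 2 * (b i - a j))) =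
      (s + 4 * R) * ∑ j, Real.exp (a j) * inner ℝ (X (w j)) (w j) := by
    rw [Finset.sum_comm]
    simp only [← Finset.mul_sum, q2]
    simp only [mul_left_comm _ s, ← Finset.mul_sum]
    linear_combination
      (-∑ j, Real.exp (a j) * ∑ i, inner ℝ (u i) (w j) ^ 2 * (b i - a j)) * hss
  have z3 : ∑ i, ∑ j, Real.exp (a j) *
      (inner ℝ (u i) (w j) ^ 2 * ((b i - a j) ^ 2 - s * R * (b i - a j))) ≤ 0 := by
    rw [Finset.sum_comm]
    simp only [← Finset.mul_sum]
    exact Finset.sum_nonpos fun j _ => mul_nonpos_of_nonneg_of_nonpos (Real.exp_pos _).le (k2 j)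
  have z4 : ∑ i, ∑ j, Real.exp (b i) *
      (inner ℝ (u i) (w j) ^ 2 * ((b i - a j) ^ 2 - s * R * (b i - a j))) ≤ 0 := by
    simp only [← Finset.mul_sum]
    exact Finset.sum_nonpos fun j _ => mul_nonpos_of_nonneg_of_nonpos (Real.exp_pos _).le (k1 j)
  linarith

end Trace

/-! ### Matrix Chernoff bound -/

section Trace

variable {E : Type*} [NormedAddCommGroup E] [InnerProductSpace ℝ E] [FiniteDimensional ℝ E]

open Classical in
/-- The trace of the exponential of a symmetric operator (and `0` for other operators). -/
noncomputable def expTrace (A : E →ₗ[ℝ] E) : ℝ :=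
  if h : A.IsSymmetric then ∑ i, Real.exp (h.eigenvalues rfl i) else 0

theorem expTrace_nonneg (A : E →ₗ[ℝ] E) : 0 ≤ expTrace A := by
  unfold expTrace
  split_ifs
  · exact Finset.sum_nonneg fun i _ => (Real.exp_pos _).le
  · exact le_rfl

theorem expTrace_zero : expTrace (0 : E →ₗ[ℝ] E) = Module.finrank ℝ E := by
  have h : (0 : E →ₗ[ℝ] E).IsSymmetric := LinearMap.IsSymmetric.zero
  have h0 (i) : h.eigenvalues rfl i = 0 := by
    have := h.apply_eigenvectorBasis rfl i
    rw [LinearMap.zero_apply, eq_comm, smul_eq_zero] at this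
    exact this.resolve_right ((h.eigenvectorBasis rfl).orthonormal.ne_zero i)
  simp [expTrace, h, h0]

/-- The exponential of the Rayleigh quotient at a unit vector is at most the exponential trace. -/
theorem exp_inner_le_expTrace {A : E →ₗ[ℝ] E} (hA : A.IsSymmetric) {u : E} (hu : ‖u‖ = 1) :
    Real.exp (inner ℝ (A u) u) ≤ expTrace A := by
  set w := hA.eigenvectorBasis rfl
  set a := hA.eigenvalues rfl
  have hw (i) : A (w i) = a i • w i := hA.apply_eigenvectorBasis rfl i
  have h1 : ∑ i, inner ℝ u (w i) ^ 2 = 1 := by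
    have := w.sum_sq_inner_left u
    simpa [hu] using this
  have h2 : inner ℝ (A u) u = ∑ i, inner ℝ u (w i) ^ 2 * a i := by
    rw [← w.sum_inner_mul_inner]
    refine Finset.sum_congr rfl fun i _ => ?_
    rw [hA, hw, real_inner_smul_right, real_inner_comm u (w i)]; ring
  -- Jensen's inequality for the spectral weights of `u`.
  have h3 : Real.exp (∑ i, inner ℝ u (w i) ^ 2 • a i) ≤
      ∑ i, inner ℝ u (w i) ^ 2 • Real.exp (a i) :=
    convexOn_exp.map_sum_le (fun i _ => sq_nonneg _) h1 (fun i _ => Set.mem_univ _)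
  simp only [smul_eq_mul] at h3
  rw [h2]
  refine h3.trans ?_
  rw [expTrace, dif_pos hA]
  refine Finset.sum_le_sum fun i _ => mul_le_of_le_one_left (Real.exp_pos _).le ?_
  rw [← h1]
  exact Finset.single_le_sum (f := fun i => inner ℝ u (w i) ^ 2)
    (fun i _ => sq_nonneg _) (Finset.mem_univ i)

/-- Averaged perturbation bound for the exponential trace. -/
theorem sum_mul_expTrace_add_le {ι : Type*} [Fintype ι] {p : ι → ℝ} (hp : ∀ j, 0 ≤ p j)
    (hp1 : ∑ j, p j = 1) {X : ι → E →ₗ[ℝ] E} {s R θ : ℝ} (hX : ∀ j, (X j).IsSymmetric)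
    (hs : s ^ 2 = 1) (hR : |R| ≤ 1 / 2) (hXR : ∀ j u, ‖X j u‖ ^ 2 ≤ R * inner ℝ (X j u) u)
    (hmean : ∀ u, ∑ j, p j * inner ℝ (X j u) u = θ * ‖u‖ ^ 2)
    {A : E →ₗ[ℝ] E} (hA : A.IsSymmetric) :
    ∑ j, p j * expTrace (A + s • X j) ≤ (1 + (s + 4 * R) * θ) * expTrace A := by
  have hB (j) : (A + s • X j).IsSymmetric := hA.add ((hX j).smul (by simp))
  set w := hA.eigenvectorBasis rfl
  set a := hA.eigenvalues rfl
  have hw (i) : A (w i) = a i • w i := hA.apply_eigenvectorBasis rfl i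
  have hAe : expTrace A = ∑ i, Real.exp (a i) := by rw [expTrace, dif_pos hA]
  have h1 (j) : expTrace (A + s • X j) ≤ expTrace A +
      (s + 4 * R) * ∑ i, Real.exp (a i) * inner ℝ (X j (w i)) (w i) := by
    rw [hAe, expTrace, dif_pos (hB j)]
    exact sum_exp_perturbation_le (hX j) hs hR (hXR j) w ((hB j).eigenvectorBasis rfl) a
      ((hB j).eigenvalues rfl) hw (fun i => (hB j).apply_eigenvectorBasis rfl i) hA
  have h2 : ∑ j, p j * ∑ i, Real.exp (a i) * inner ℝ (X j (w i)) (w i) = θ * expTrace A := by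
    simp only [Finset.mul_sum]
    rw [Finset.sum_comm, hAe, Finset.mul_sum]
    refine Finset.sum_congr rfl fun i _ => ?_
    simp only [mul_left_comm (p _), ← Finset.mul_sum, hmean]
    simp [mul_comm]
  calc ∑ j, p j * expTrace (A + s • X j)
      ≤ ∑ j, p j * (expTrace A +
        (s + 4 * R) * ∑ i, Real.exp (a i) * inner ℝ (X j (w i)) (w i)) :=
        Finset.sum_le_sum fun j _ => mul_le_mul_of_nonneg_left (h1 j) (hp j)
    _ = (1 + (s + 4 * R) * θ) * expTrace A := by
        simp only [mul_add, Finset.sum_add_distrib, mul_left_comm (p _), ← Finset.mul_sum, h2]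
        rw [← Finset.sum_mul, hp1]
        ring

/-- Induction on the number of samples: the first summand is absorbed into `A`, so `A` must stay
arbitrary. -/
theorem sum_prod_mul_expTrace_le {ι : Type*} [Fintype ι] {p : ι → ℝ} (hp : ∀ j, 0 ≤ p j)
    (hp1 : ∑ j, p j = 1) {X : ι → E →ₗ[ℝ] E} {s R θ : ℝ} (hX : ∀ j, (X j).IsSymmetric)
    (hs : s ^ 2 = 1) (hR : |R| ≤ 1 / 2) (hXR : ∀ j u, ‖X j u‖ ^ 2 ≤ R * inner ℝ (X j u) u)
    (hmean : ∀ u, ∑ j, p j * inner ℝ (X j u) u = θ * ‖u‖ ^ 2) (m : ℕ)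
    {A : E →ₗ[ℝ] E} (hA : A.IsSymmetric) :
    ∑ J : Fin m → ι, (∏ i, p (J i)) * expTrace (A + ∑ i, s • X (J i)) ≤
      Real.exp (m * ((s + 4 * R) * θ)) * expTrace A := by
  induction m generalizing A with
  | zero => simp
  | succ m ih =>
    have hB (j) : (A + s • X j).IsSymmetric := hA.add ((hX j).smul (by simp))
    rw [← (Fin.consEquiv fun _ => ι).sum_comp, Fintype.sum_prod_type]
    calc _ = ∑ j, p j * ∑ J : Fin m → ι, (∏ i, p (J i)) *
          expTrace ((A + s • X j) + ∑ i, s • X (J i)) := by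
          simp [Fin.consEquiv, Fin.prod_univ_succ, Fin.sum_univ_succ, Finset.mul_sum, mul_assoc,
            add_assoc]
      _ ≤ ∑ j, p j * (Real.exp (m * ((s + 4 * R) * θ)) * expTrace (A + s • X j)) :=
          Finset.sum_le_sum fun j _ => mul_le_mul_of_nonneg_left (ih (hB j)) (hp j)
      _ = Real.exp (m * ((s + 4 * R) * θ)) * ∑ j, p j * expTrace (A + s • X j) := by
          rw [Finset.mul_sum]
          exact Finset.sum_congr rfl fun j _ => by ring
      _ ≤ Real.exp (m * ((s + 4 * R) * θ)) * (Real.exp ((s + 4 * R) * θ) * expTrace A) := by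
          gcongr
          refine (sum_mul_expTrace_add_le hp hp1 hX hs hR hXR hmean hA).trans ?_
          gcongr
          · exact expTrace_nonneg A
          · linarith [Real.add_one_le_exp ((s + 4 * R) * θ)]
      _ = _ := by
          rw [← mul_assoc, ← Real.exp_add]
          congr 2
          push_cast
          ring

/-- One-sided tail bound for sums of independent positive random operators on a
finite-dimensional space. -/
theorem sum_prod_filter_le_exp {ι : Type*} [Fintype ι] {p : ι → ℝ} (hp : ∀ j, 0 ≤ p j)
    (hp1 : ∑ j, p j = 1) {X : ι → E →ₗ[ℝ] E} {s R θ : ℝ} (hX : ∀ j, (X j).IsSymmetric)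
    (hs : s ^ 2 = 1) (hR : |R| ≤ 1 / 2) (hXR : ∀ j u, ‖X j u‖ ^ 2 ≤ R * inner ℝ (X j u) u)
    (hmean : ∀ u, ∑ j, p j * inner ℝ (X j u) u = θ * ‖u‖ ^ 2) (m : ℕ) (x : ℝ)
    (B : Finset (Fin m → ι))
    (hB : ∀ J ∈ B, ∃ u : E, ‖u‖ = 1 ∧ x ≤ s * ∑ i, inner ℝ (X (J i) u) u) :
    ∑ J ∈ B, ∏ i, p (J i) ≤
      Module.finrank ℝ E * Real.exp (m * ((s + 4 * R) * θ) - x) := by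
  have h := sum_prod_mul_expTrace_le hp hp1 hX hs hR hXR hmean m
    (A := 0) LinearMap.IsSymmetric.zero
  simp only [zero_add, expTrace_zero] at h
  have hsym (J : Fin m → ι) : (∑ i, s • X (J i)).IsSymmetric := by
    intro u v
    simp only [LinearMap.sum_apply, sum_inner, inner_sum, LinearMap.smul_apply,
      real_inner_smul_left, real_inner_smul_right, (hX _) u v]
  have hpos (J : Fin m → ι) : 0 ≤ ∏ i, p (J i) := Finset.prod_nonneg fun i _ => hp _
  -- Markov's inequality: each `J ∈ B` has exponential trace at least `e^x`, by its Rayleigh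
  -- quotient at `u`.
  have key : (∑ J ∈ B, ∏ i, p (J i)) * Real.exp x ≤
      Real.exp (m * ((s + 4 * R) * θ)) * Module.finrank ℝ E := by
    refine le_trans ?_ h
    rw [Finset.sum_mul]
    refine le_trans (Finset.sum_le_sum fun J hJ => ?_) (Finset.sum_le_sum_of_subset_of_nonneg
      (Finset.subset_univ B) fun J _ _ => mul_nonneg (hpos J) (expTrace_nonneg _))
    obtain ⟨u, hu, hx⟩ := hB J hJ
    refine mul_le_mul_of_nonneg_left (le_trans (Real.exp_le_exp.2 (hx.trans_eq ?_))
      (exp_inner_le_expTrace (hsym J) hu)) (hpos J)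
    simp only [LinearMap.sum_apply, sum_inner, LinearMap.smul_apply, real_inner_smul_left,
      Finset.mul_sum]
  rw [Real.exp_sub, ← mul_div_assoc, le_div_iff₀ (Real.exp_pos x), mul_comm (Module.finrank ℝ E : ℝ)]
  exact key

/-- Concentration of sums of independent random quadratic forms `‖L_j u‖²`, uniformly over the
unit sphere of a finite-dimensional space. -/
theorem sum_prod_filter_deviation_le {ι G : Type*} [Fintype ι] [NormedAddCommGroup G]
    [InnerProductSpace ℝ G] [FiniteDimensional ℝ G] {p : ι → ℝ} (hp : ∀ j, 0 ≤ p j)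
    (hp1 : ∑ j, p j = 1) (L : ι → E →ₗ[ℝ] G) {K : ℝ} (hK : 0 < K)
    (hL : ∀ j u, ‖L j u‖ ^ 2 ≤ K * ‖u‖ ^ 2)
    (hmean : ∀ u, ∑ j, p j * ‖L j u‖ ^ 2 = ‖u‖ ^ 2) (m : ℕ) (B : Finset (Fin m → ι))
    (hB : ∀ J ∈ B, ∃ u : E, ‖u‖ = 1 ∧ m / 3 ≤ |∑ i, ‖L (J i) u‖ ^ 2 - m|) :
    ∑ J ∈ B, ∏ i, p (J i) ≤ 2 * Module.finrank ℝ E * Real.exp (-(m / (144 * K))) := by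
  classical
  -- This scaling gives `R = θK = 1/24`, so `4R = 1/6`. Both tails then have exponent `-mθ/6`, since
  -- `7/6 - 4/3 = -5/6 + 2/3 = -1/6`.
  set θ : ℝ := 1 / (24 * K)
  have hθ : 0 < θ := by positivity
  have hθK : θ * K = 1 / 24 := by simp only [θ]; field_simp
  let X (j : ι) : E →ₗ[ℝ] E := θ • (L j).adjoint ∘ₗ L j
  have hXin (j) (u v : E) : inner ℝ (X j u) v = θ * inner ℝ (L j u) (L j v) := by
    simp [X, real_inner_smul_left, LinearMap.adjoint_inner_left]
  have hXu (j) (u : E) : inner ℝ (X j u) u = θ * ‖L j u‖ ^ 2 := by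
    rw [hXin, real_inner_self_eq_norm_sq]
  have hX (j) : (X j).IsSymmetric := fun u v => by
    rw [hXin, ← real_inner_comm u, hXin, real_inner_comm]
  -- Cauchy–Schwarz, then `hL` at the vector `X j u`; square and cancel `‖X j u‖²`.
  have hXR (j) (u : E) : ‖X j u‖ ^ 2 ≤ 1 / 24 * inner ℝ (X j u) u := by
    have h1 : ‖X j u‖ ^ 2 = θ * inner ℝ (L j u) (L j (X j u)) := by
      rw [← real_inner_self_eq_norm_sq, hXin]
    have h2 : inner ℝ (L j u) (L j (X j u)) ≤ ‖L j u‖ * ‖L j (X j u)‖ := real_inner_le_norm _ _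
    have h3 := hL j (X j u)
    have h4 : ‖X j u‖ ^ 2 ≤ θ * (‖L j u‖ * ‖L j (X j u)‖) := by
      rw [h1]; gcongr
    rw [hXu]
    have h5 : 0 ≤ ‖X j u‖ ^ 2 := sq_nonneg _
    have h6 : ‖X j u‖ ^ 2 * ‖X j u‖ ^ 2 ≤ (1 / 24 * (θ * ‖L j u‖ ^ 2)) * ‖X j u‖ ^ 2 := by
      calc ‖X j u‖ ^ 2 * ‖X j u‖ ^ 2
          ≤ (θ * (‖L j u‖ * ‖L j (X j u)‖)) * (θ * (‖L j u‖ * ‖L j (X j u)‖)) := by gcongr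
        _ = θ ^ 2 * ‖L j u‖ ^ 2 * ‖L j (X j u)‖ ^ 2 := by ring
        _ ≤ θ ^ 2 * ‖L j u‖ ^ 2 * (K * ‖X j u‖ ^ 2) := by gcongr
        _ = _ := by linear_combination (θ * ‖L j u‖ ^ 2 * ‖X j u‖ ^ 2) * hθK
    rcases h5.eq_or_lt with h | h
    · rw [← h]; positivity
    · exact le_of_mul_le_mul_right h6 h
  have hm (u : E) : ∑ j, p j * inner ℝ (X j u) u = θ * ‖u‖ ^ 2 := by
    simp only [hXu, mul_left_comm (p _), ← Finset.mul_sum, hmean]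
  have hexp : m * θ / 6 = m / (144 * K) := by simp only [θ]; field_simp; ring
  have hup := sum_prod_filter_le_exp hp hp1 hX (s := 1) (by norm_num)
    (R := 1 / 24) (by rw [abs_of_pos] <;> norm_num) hXR hm m (θ * (4 / 3 * m))
    {J ∈ B | ∃ u : E, ‖u‖ = 1 ∧ 4 / 3 * m ≤ ∑ i, ‖L (J i) u‖ ^ 2} (by
      intro J hJ
      obtain ⟨u, hu, h⟩ := (Finset.mem_filter.1 hJ).2
      refine ⟨u, hu, ?_⟩
      simp only [hXu, ← Finset.mul_sum, one_mul]
      gcongr)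
  have hlo := sum_prod_filter_le_exp hp hp1 hX (s := -1) (by norm_num)
    (R := 1 / 24) (by rw [abs_of_pos] <;> norm_num) hXR hm m (-(θ * (2 / 3 * m)))
    {J ∈ B | ¬ ∃ u : E, ‖u‖ = 1 ∧ 4 / 3 * m ≤ ∑ i, ‖L (J i) u‖ ^ 2} (by
      intro J hJ
      obtain ⟨hJB, h⟩ := Finset.mem_filter.1 hJ
      obtain ⟨u, hu, hd⟩ := hB J hJB
      refine ⟨u, hu, ?_⟩
      simp only [hXu, ← Finset.mul_sum, neg_mul, one_mul]
      gcongr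
      -- Upward deviation is excluded here, so the sum falls below `2m/3`.
      push Not at h
      have := h u hu
      rcases le_abs.1 hd with h' | h' <;> linarith)
  rw [← Finset.sum_filter_add_sum_filter_not B
    (fun J => ∃ u : E, ‖u‖ = 1 ∧ 4 / 3 * m ≤ ∑ i, ‖L (J i) u‖ ^ 2)]
  refine (add_le_add hup hlo).trans_eq ?_
  rw [← hexp]
  have e1 : m * ((1 + 4 * (1 / 24)) * θ) - θ * (4 / 3 * m) = -(m * θ / 6) := by ring
  have e2 : m * ((-1 + 4 * (1 / 24)) * θ) - -(θ * (2 / 3 * m)) = -(m * θ / 6) := by ring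
  rw [e1, e2]
  ring

end Trace

/-! ### Coherence, unitarity and the preconditioned matrix -/

section Matrices

variable {𝕜 : Type*} [RCLike 𝕜] {n m : ℕ}

theorem inner_rowVector (F : Matrix (Fin n) (Fin n) 𝕜) (j : Fin n) (x : EuclideanSpace 𝕜 (Fin n)) :
    inner 𝕜 (rowVector F j) x = F.mulVec x.ofLp j := by
  rw [EuclideanSpace.inner_eq_star_dotProduct, Matrix.mulVec, dotProduct_comm]
  congr 1
  ext k
  simp [rowVector]

theorem norm_inner_rowVector_le {F : Matrix (Fin n) (Fin n) 𝕜} {T : Set (EuclideanSpace 𝕜 (Fin n))}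
    {p : Fin n → ℝ} (hp : ∀ j, 0 < p j) {x : EuclideanSpace 𝕜 (Fin n)} (hx : x ∈ T)
    (hx1 : ‖x‖ ≤ 1) (j : Fin n) :
    ‖inner 𝕜 (rowVector F j) x‖ ≤
      samplingComplexity (localCoherences F T) p * Real.sqrt (p j) := by
  have h1 : ‖inner 𝕜 (rowVector F j) x‖ ≤ localCoherences F T j := by
    refine le_csSup ⟨‖rowVector F j‖, ?_⟩ ⟨x, ⟨hx, by simpa using hx1⟩, rfl⟩
    rintro _ ⟨y, ⟨-, hy⟩, rfl⟩
    refine (norm_inner_le_norm _ _).trans (mul_le_of_le_one_right (norm_nonneg _) ?_)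
    simpa using hy
  have h2 : localCoherences F T j / Real.sqrt (p j) ≤
      samplingComplexity (localCoherences F T) p :=
    le_ciSup (f := fun j => localCoherences F T j / Real.sqrt (p j)) (Set.finite_range _).bddAbove j
  exact h1.trans ((div_le_iff₀ (Real.sqrt_pos.2 (hp j))).1 h2)

theorem sum_norm_sq_mulVec {F : Matrix (Fin n) (Fin n) 𝕜} (hF : F ∈ Matrix.unitaryGroup (Fin n) 𝕜)
    (x : EuclideanSpace 𝕜 (Fin n)) : ∑ j, ‖F.mulVec x.ofLp j‖ ^ 2 = ‖x‖ ^ 2 := by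
  have h : F.mulVec x.ofLp ⬝ᵥ star (F.mulVec x.ofLp) = x.ofLp ⬝ᵥ star x.ofLp := by
    rw [Matrix.star_mulVec, dotProduct_comm, ← Matrix.dotProduct_mulVec, Matrix.mulVec_mulVec,
      ← Matrix.star_eq_conjTranspose, Matrix.mem_unitaryGroup_iff'.1 hF, Matrix.one_mulVec,
      dotProduct_comm]
  rw [EuclideanSpace.norm_sq_eq]
  have h' : ∀ y : Fin n → 𝕜, y ⬝ᵥ star y = ((∑ j, ‖y j‖ ^ 2 : ℝ) : 𝕜) := fun y => by
    simp [dotProduct, RCLike.mul_conj]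
  rw [h', h'] at h
  exact_mod_cast h

theorem norm_sq_preconditioned {S : Matrix (Fin m) (Fin n) ℝ} {p : Fin n → ℝ}
    (hn : 0 < n) (hp : ∀ j, 0 < p j) {J : Fin m → Fin n}
    (hS : ∀ i, S i = Pi.single (J i) (Real.sqrt ((n : ℝ) / m)))
    (F : Matrix (Fin n) (Fin n) 𝕜) (u : EuclideanSpace 𝕜 (Fin n)) :
    ‖Matrix.toEuclideanLin (preconditioned S p F) u‖ ^ 2 =
      (∑ i, ‖F.mulVec u.ofLp (J i)‖ ^ 2 / p (J i)) / m := by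
  have hn' : (0 : ℝ) < n := by exact_mod_cast hn
  rw [EuclideanSpace.norm_sq_eq, Finset.sum_div]
  refine Finset.sum_congr rfl fun i _ => ?_
  have hrow (k) : (S * Matrix.diagonal (fun i => (Real.sqrt (n * p i))⁻¹)) i k =
      if k = J i then Real.sqrt ((n : ℝ) / m) * (Real.sqrt (n * p k))⁻¹ else 0 := by
    rw [Matrix.mul_diagonal, hS, Pi.single_apply]
    split_ifs <;> simp
  have h : (Matrix.toEuclideanLin (preconditioned S p F) u).ofLp i =
      ((Real.sqrt ((n : ℝ) / m) * (Real.sqrt (n * p (J i)))⁻¹ : ℝ) : 𝕜) *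
        F.mulVec u.ofLp (J i) := by
    rw [Matrix.ofLp_toLpLin, Matrix.toLin'_apply, preconditioned, ← Matrix.mulVec_mulVec,
      Matrix.mulVec, dotProduct, Finset.sum_eq_single (J i)]
    · rw [Matrix.map_apply, hrow, if_pos rfl]
    · intro k _ hk
      rw [Matrix.map_apply, hrow, if_neg hk]
      simp
    · simp
  rw [h, norm_mul, mul_pow, RCLike.norm_ofReal, sq_abs, mul_pow, inv_pow,
    Real.sq_sqrt (by positivity), Real.sq_sqrt (mul_pos hn' (hp _)).le]
  have := hp (J i)
  field_simp

theorem abs_norm_preconditioned_sub_one_le {S : Matrix (Fin m) (Fin n) ℝ} {p : Fin n → ℝ}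
    (hn : 0 < n) (hm : 0 < m) (hp : ∀ j, 0 < p j) {J : Fin m → Fin n}
    (hS : ∀ i, S i = Pi.single (J i) (Real.sqrt ((n : ℝ) / m)))
    {F : Matrix (Fin n) (Fin n) 𝕜} {u : EuclideanSpace 𝕜 (Fin n)}
    (h : |∑ i, ‖F.mulVec u.ofLp (J i)‖ ^ 2 / p (J i) - m| ≤ m / 3) :
    |‖Matrix.toEuclideanLin (preconditioned S p F) u‖ - 1| ≤ 1 / 3 := by
  have hm' : (0 : ℝ) < m := by exact_mod_cast hm
  have hsq := norm_sq_preconditioned hn hp hS F u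
  set N := ‖Matrix.toEuclideanLin (preconditioned S p F) u‖
  have hN : 0 ≤ N := norm_nonneg _
  rw [eq_div_iff hm'.ne'] at hsq
  rw [← hsq, show N ^ 2 * m - m = (N ^ 2 - 1) * m by ring, abs_mul, abs_of_pos hm',
    div_eq_inv_mul, mul_le_mul_iff_left₀ hm', show N ^ 2 - 1 = (N - 1) * (N + 1) by ring,
    abs_mul, abs_of_nonneg (by linarith : 0 ≤ N + 1)] at h
  -- `|N - 1| ≤ |N - 1|(N + 1) = |N² - 1|`, as `N ≥ 0`.
  nlinarith [abs_nonneg (N - 1)]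

end Matrices

/-! ### From index tuples to the sampling matrix -/

section Sampling

theorem IsWithReplacementSampling.measureReal_forall_eq {Ω : Type*} [MeasurableSpace Ω]
    {P : Measure Ω} {m n : ℕ} {p : Fin n → ℝ}
    {S : Ω → Matrix (Fin m) (Fin n) ℝ} (hS : IsWithReplacementSampling P p S) (J : Fin m → Fin n) :
    P.real {ω | ∀ i, S ω i = Pi.single (J i) (Real.sqrt ((n : ℝ) / m))} = ∏ i, p (J i) := by
  have h := hS.indep_rows.measure_inter_preimage_eq_mul Finset.univ
    (sets := fun i => {Pi.single (J i) (Real.sqrt ((n : ℝ) / m))})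
    (fun i _ => measurableSet_singleton _)
  have hset : {ω | ∀ i, S ω i = Pi.single (J i) (Real.sqrt ((n : ℝ) / m))} =
      ⋂ i ∈ Finset.univ, (fun ω => (S ω i : Fin n → ℝ)) ⁻¹'
        {Pi.single (J i) (Real.sqrt ((n : ℝ) / m))} := by
    ext ω; simp
  rw [hset, Measure.real, h, ENNReal.toReal_prod]
  exact Finset.prod_congr rfl fun i _ => hS.prob_row i (J i)

theorem IsWithReplacementSampling.sum_prod_le_measureReal {Ω : Type*} [MeasurableSpace Ω]
    {P : Measure Ω} [IsFiniteMeasure P] {m n : ℕ} (hn : 0 < n) (hm : 0 < m) {p : Fin n → ℝ}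
    {S : Ω → Matrix (Fin m) (Fin n) ℝ} (hS : IsWithReplacementSampling P p S)
    (G : Finset (Fin m → Fin n)) {A : Set Ω}
    (hA : ∀ J ∈ G, ∀ ω, (∀ i, S ω i = Pi.single (J i) (Real.sqrt ((n : ℝ) / m))) → ω ∈ A) :
    ∑ J ∈ G, ∏ i, p (J i) ≤ P.real A := by
  -- A nonzero amplitude makes the events for distinct tuples disjoint.
  have hc : Real.sqrt ((n : ℝ) / m) ≠ 0 := by positivity
  simp only [← hS.measureReal_forall_eq]
  rw [← measureReal_biUnion_finset]
  · refine measureReal_mono ?_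
    intro ω hω
    simp only [Set.mem_iUnion, Set.mem_ofPred_eq] at hω
    obtain ⟨J, hJ, h⟩ := hω
    exact hA J hJ ω h
  · intro J _ J' _ hne
    refine Set.disjoint_left.2 fun ω h h' => hne (funext fun i => ?_)
    have := congrFun ((h i).symm.trans (h' i)) (J i)
    by_contra hi
    rw [Pi.single_eq_same, Pi.single_eq_of_ne hi] at this
    exact hc this
  · intro J _
    rw [Set.ofPred_forall]
    exact MeasurableSet.iInter fun i => hS.measurable_row i (measurableSet_singleton _)

end Sampling

/-! ### Restricted isometry on one subspace and on unions -/

section RestrictedIsometry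

variable {𝕜 : Type*} [RCLike 𝕜] {n : ℕ}

/-- The index tuples for which the restricted isometry property may fail on the image of a
finite-dimensional real space have small weight. -/
theorem exists_exceptional_tuples {E : Type*} [NormedAddCommGroup E] [InnerProductSpace ℝ E]
    [FiniteDimensional ℝ E] {F : Matrix (Fin n) (Fin n) 𝕜}
    (hF : F ∈ Matrix.unitaryGroup (Fin n) 𝕜) {T : Set (EuclideanSpace 𝕜 (Fin n))}
    {p : Fin n → ℝ} (hp : ∀ j, 0 < p j) (hp1 : ∑ j, p j = 1)
    (hμ : 0 < samplingComplexity (localCoherences F T) p) (Φ : E →ₗ[ℝ] EuclideanSpace 𝕜 (Fin n))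
    (hΦ : ∀ u, ‖Φ u‖ = ‖u‖) (hΦT : ∀ u, Φ u ∈ T) (m : ℕ) :
    ∃ B : Finset (Fin m → Fin n), ∑ J ∈ B, ∏ i, p (J i) ≤ 2 * Module.finrank ℝ E *
        Real.exp (-(m / (144 * samplingComplexity (localCoherences F T) p ^ 2))) ∧
      ∀ J ∉ B, ∀ u : E, ‖u‖ = 1 →
        |∑ i, ‖F.mulVec (Φ u).ofLp (J i)‖ ^ 2 / p (J i) - m| ≤ m / 3 := by
  classical
  set μ := samplingComplexity (localCoherences F T) p
  -- The normalisation `p_j^(-1/2)` makes the forms isotropic on average and bounded with `K = μ²`.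
  let L (j : Fin n) : E →ₗ[ℝ] 𝕜 := (Real.sqrt (p j))⁻¹ •
    ((innerSL 𝕜 (rowVector F j)).toLinearMap.restrictScalars ℝ ∘ₗ Φ)
  have hLn (j) (u : E) : ‖L j u‖ = (Real.sqrt (p j))⁻¹ * ‖inner 𝕜 (rowVector F j) (Φ u)‖ := by
    simp [L, norm_smul, abs_of_nonneg (Real.sqrt_nonneg _)]
  have hL2 (j) (u : E) : ‖L j u‖ ^ 2 = ‖F.mulVec (Φ u).ofLp j‖ ^ 2 / p j := by
    rw [hLn, mul_pow, inv_pow, Real.sq_sqrt (hp j).le, inner_rowVector, div_eq_inv_mul]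
  have hL1 (j) (u : E) (hu : ‖u‖ = 1) : ‖L j u‖ ≤ μ := by
    rw [hLn, inv_mul_le_iff₀ (Real.sqrt_pos.2 (hp j)), mul_comm]
    exact norm_inner_rowVector_le hp (hΦT u) (by rw [hΦ, hu]) j
  have hL (j) (u : E) : ‖L j u‖ ^ 2 ≤ μ ^ 2 * ‖u‖ ^ 2 := by
    rcases eq_or_ne u 0 with rfl | hu
    · simp
    · have h := hL1 j (‖u‖⁻¹ • u) (norm_smul_inv_norm hu)
      rw [map_smul, norm_smul, norm_inv, norm_norm, inv_mul_le_iff₀ (norm_pos_iff.2 hu)] at h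
      rw [← mul_pow, mul_comm μ]
      gcongr
  have hmean (u : E) : ∑ j, p j * ‖L j u‖ ^ 2 = ‖u‖ ^ 2 := by
    rw [← hΦ u, ← sum_norm_sq_mulVec hF]
    refine Finset.sum_congr rfl fun j _ => ?_
    rw [hL2, mul_div_cancel₀ _ (hp j).ne']
  refine ⟨Finset.univ.filter fun J : Fin m → Fin n =>
      ∃ u : E, ‖u‖ = 1 ∧ (m : ℝ) / 3 ≤ |∑ i, ‖L (J i) u‖ ^ 2 - m|,
    sum_prod_filter_deviation_le (fun j => (hp j).le) hp1 L (pow_pos hμ 2) hL hmean m _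
      fun J hJ => (Finset.mem_filter.1 hJ).2, fun J hJ u hu => ?_⟩
  by_contra hcon
  refine hJ (Finset.mem_filter.2 ⟨Finset.mem_univ _, u, hu, ?_⟩)
  simp only [hL2]
  exact (not_le.1 hcon).le

/-- Version of `exists_exceptional_tuples` for a space over `𝕜`, regarded as a real space. -/
theorem exists_exceptional_tuples_rclike {E : Type*} [NormedAddCommGroup E]
    [InnerProductSpace 𝕜 E] [FiniteDimensional 𝕜 E] {F : Matrix (Fin n) (Fin n) 𝕜}
    (hF : F ∈ Matrix.unitaryGroup (Fin n) 𝕜) {T : Set (EuclideanSpace 𝕜 (Fin n))}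
    {p : Fin n → ℝ} (hp : ∀ j, 0 < p j) (hp1 : ∑ j, p j = 1)
    (hμ : 0 < samplingComplexity (localCoherences F T) p) (Φ : E →ₗᵢ[𝕜] EuclideanSpace 𝕜 (Fin n))
    (hΦT : ∀ u, Φ u ∈ T) (m : ℕ) :
    ∃ B : Finset (Fin m → Fin n), ∑ J ∈ B, ∏ i, p (J i) ≤
        2 * (2 * Module.finrank 𝕜 E : ℕ) *
          Real.exp (-(m / (144 * samplingComplexity (localCoherences F T) p ^ 2))) ∧
      ∀ J ∉ B, ∀ u : E, ‖u‖ = 1 →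
        |∑ i, ‖F.mulVec (Φ u).ofLp (J i)‖ ^ 2 / p (J i) - m| ≤ m / 3 := by
  let : InnerProductSpace ℝ E := InnerProductSpace.rclikeToReal 𝕜 E
  have : IsScalarTower ℝ 𝕜 E := IsScalarTower.of_algebraMap_smul fun _ _ => rfl
  have : FiniteDimensional ℝ E := FiniteDimensional.trans ℝ 𝕜 E
  have hd : Module.finrank ℝ E ≤ 2 * Module.finrank 𝕜 E := by
    rw [← Module.finrank_mul_finrank ℝ 𝕜 E]
    exact Nat.mul_le_mul_right _ (RCLike.finrank_le_two 𝕜)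
  obtain ⟨B, hBb, hB⟩ :=
    exists_exceptional_tuples hF hp hp1 hμ (Φ.toLinearMap.restrictScalars ℝ) Φ.norm_map hΦT m
  refine ⟨B, hBb.trans ?_, hB⟩
  gcongr

theorem exists_exceptional_tuples_submodule {F : Matrix (Fin n) (Fin n) 𝕜}
    (hF : F ∈ Matrix.unitaryGroup (Fin n) 𝕜) {T : Set (EuclideanSpace 𝕜 (Fin n))}
    {p : Fin n → ℝ} (hp : ∀ j, 0 < p j) (hp1 : ∑ j, p j = 1)
    (hμ : 0 < samplingComplexity (localCoherences F T) p)
    (U : Submodule 𝕜 (EuclideanSpace 𝕜 (Fin n))) (hUT : (U : Set _) ⊆ T) (m : ℕ) :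
    ∃ B : Finset (Fin m → Fin n), ∑ J ∈ B, ∏ i, p (J i) ≤
        2 * (2 * Module.finrank 𝕜 U : ℕ) *
          Real.exp (-(m / (144 * samplingComplexity (localCoherences F T) p ^ 2))) ∧
      ∀ J ∉ B, ∀ u ∈ U, ‖u‖ = 1 →
        |∑ i, ‖F.mulVec u.ofLp (J i)‖ ^ 2 / p (J i) - m| ≤ m / 3 := by
  obtain ⟨B, hBb, hB⟩ :=
    exists_exceptional_tuples_rclike (E := U) hF hp hp1 hμ U.subtypeₗᵢ (fun u => hUT u.2) m
  exact ⟨B, hBb, fun J hJ u hu hu1 => hB J hJ ⟨u, hu⟩ hu1⟩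

/-- The canonical embedding of `ℝⁿ` into `𝕜ⁿ` as a linear map. -/
noncomputable def realEmbedLinear (𝕜 : Type*) [RCLike 𝕜] (n : ℕ) :
    EuclideanSpace ℝ (Fin n) →ₗ[ℝ] EuclideanSpace 𝕜 (Fin n) where
  toFun := realEmbed 𝕜
  map_add' x y := by ext i; simp [realEmbed]
  map_smul' r x := by ext i; simp [realEmbed, RCLike.real_smul_eq_coe_mul]

theorem norm_realEmbed (x : EuclideanSpace ℝ (Fin n)) : ‖realEmbed 𝕜 x‖ = ‖x‖ := by
  simp [EuclideanSpace.norm_eq, realEmbed]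

theorem sum_biUnion_le_sum_sum {κ α : Type*} [DecidableEq α] (I : Finset κ) (B : κ → Finset α)
    {f : α → ℝ} (hf : ∀ a, 0 ≤ f a) : ∑ a ∈ I.biUnion B, f a ≤ ∑ k ∈ I, ∑ a ∈ B k, f a := by
  classical
  induction I using Finset.induction_on with
  | empty => simp
  | insert k I hk ih =>
    rw [Finset.biUnion_insert, Finset.sum_insert hk]
    have := Finset.sum_union_inter (s₁ := B k) (s₂ := I.biUnion B) (f := f)
    have := Finset.sum_nonneg fun a (_ : a ∈ B k ∩ I.biUnion B) => hf a
    linarith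

/-- Union bound over exceptional sets of tuples; any tuple outside all of them forces the isometry
property on every `V k`. -/
theorem measureReal_hasRIP_of_iUnion {Ω : Type*} [MeasurableSpace Ω] {P : Measure Ω}
    [IsProbabilityMeasure P] {m : ℕ} (hn : 0 < n) (hm : 0 < m) {F : Matrix (Fin n) (Fin n) 𝕜}
    {p : Fin n → ℝ} (hp : ∀ j, 0 < p j) (hp1 : ∑ j, p j = 1)
    {S : Ω → Matrix (Fin m) (Fin n) ℝ} (hS : IsWithReplacementSampling P p S)
    {κ : Type*} (I : Finset κ) (V : κ → Set (EuclideanSpace 𝕜 (Fin n))) {b : ℝ}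
    (hV : ∀ k ∈ I, ∃ B : Finset (Fin m → Fin n), ∑ J ∈ B, ∏ i, p (J i) ≤ b ∧
      ∀ J ∉ B, ∀ u ∈ V k, ‖u‖ = 1 →
        |∑ i, ‖F.mulVec u.ofLp (J i)‖ ^ 2 / p (J i) - m| ≤ m / 3) :
    1 - I.card * b ≤ P.real {ω | HasRIP (preconditioned (S ω) p F) (⋃ k ∈ I, V k)} := by
  classical
  choose! B hBb hB using hV
  have htot : ∑ J : Fin m → Fin n, ∏ i, p (J i) = 1 := by
    rw [← Fintype.piFinset_univ, ← Finset.prod_univ_sum]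
    simp [hp1]
  have hpos (J : Fin m → Fin n) : 0 ≤ ∏ i, p (J i) := Finset.prod_nonneg fun i _ => (hp _).le
  have hbad : ∑ J ∈ I.biUnion B, ∏ i, p (J i) ≤ I.card * b := by
    calc ∑ J ∈ I.biUnion B, ∏ i, p (J i) ≤ ∑ k ∈ I, ∑ J ∈ B k, ∏ i, p (J i) :=
          sum_biUnion_le_sum_sum I B hpos
      _ ≤ ∑ _k ∈ I, b := Finset.sum_le_sum hBb
      _ = I.card * b := by simp
  have hgood := hS.sum_prod_le_measureReal hn hm (I.biUnion B)ᶜ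
    (A := {ω | HasRIP (preconditioned (S ω) p F) (⋃ k ∈ I, V k)}) (by
      intro J hJ ω hω u hu hu1
      simp only [Set.mem_iUnion] at hu
      obtain ⟨k, hk, huk⟩ := hu
      refine abs_norm_preconditioned_sub_one_le hn hm hp hω (hB k hk J (fun hJB => ?_) u huk hu1)
      exact Finset.mem_compl.1 hJ (Finset.mem_biUnion.2 ⟨k, hk, hJB⟩))
  have := Finset.sum_add_sum_compl (I.biUnion B) fun J => ∏ i, p (J i)
  linarith

end RestrictedIsometry

/-! ### Constants and conclusion -/

/-- The prefactor `4ℓM` (two tails, real dimension `2ℓ`, `M` subspaces) is absorbed by half of `x`,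
up to the factor 2 that remains; `log 2 ≤ t²` pays for the other 2. -/
theorem mul_exp_le_two_mul_exp {ℓ M N t x : ℝ} (hℓ : 1 ≤ ℓ) (hM : 1 ≤ M) (hN : N ≤ M)
    (ht : Real.log 2 ≤ t ^ 2) (hx : 2 * (Real.log ℓ + Real.log M + t ^ 2) ≤ x) :
    N * (2 * (2 * ℓ) * Real.exp (-x)) ≤ 2 * Real.exp (-t ^ 2) := by
  have h1 : Real.exp (-x) ≤ Real.exp (-(Real.log ℓ + Real.log M + Real.log 2 + t ^ 2)) := by
    have := Real.log_nonneg hℓ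
    have := Real.log_nonneg hM
    gcongr
    linarith
  have h2 : Real.exp (-(Real.log ℓ + Real.log M + Real.log 2 + t ^ 2)) =
      (ℓ * M * 2)⁻¹ * Real.exp (-t ^ 2) := by
    rw [neg_add, Real.exp_add, Real.exp_neg, Real.exp_add, Real.exp_add, Real.exp_log,
      Real.exp_log, Real.exp_log] <;> linarith
  calc N * (2 * (2 * ℓ) * Real.exp (-x))
      ≤ M * (2 * (2 * ℓ) * ((ℓ * M * 2)⁻¹ * Real.exp (-t ^ 2))) := by
        rw [h2] at h1
        gcongr
    _ = 2 * Real.exp (-t ^ 2) := by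
        have : ℓ ≠ 0 := by linarith
        have : M ≠ 0 := by linarith
        field_simp

theorem mainTheorem3 :
    ∃ C : ℝ, 0 < C ∧
      ∀ (𝕜 : Type*) [RCLike 𝕜] (Ω : Type*) [MeasurableSpace Ω]
        (P : Measure Ω) [IsProbabilityMeasure P]
        (n m ℓ M : ℕ) (_ : 1 ≤ ℓ) (_ : 1 ≤ M)
        (F : Matrix (Fin n) (Fin n) 𝕜) (_ : F ∈ Matrix.unitaryGroup (Fin n) 𝕜)
        (T : Set (EuclideanSpace 𝕜 (Fin n)))
        (_ : IsUnionOfSubspaces 𝕜 M ℓ T ∨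
          ∃ T₀ : Set (EuclideanSpace ℝ (Fin n)),
            IsUnionOfSubspaces ℝ M ℓ T₀ ∧ T = realEmbed 𝕜 '' T₀)
        (p : Fin n → ℝ) (_ : p ∈ stdSimplex ℝ (Fin n)) (_ : ∀ j, 0 < p j)
        (S : Ω → Matrix (Fin m) (Fin n) ℝ) (_ : IsWithReplacementSampling P p S)
        (t : ℝ) (_ : 0 < t),
        C * (samplingComplexity (localCoherences F T) p ^ 2 *
            (Real.log ℓ + Real.log M + t ^ 2)) ≤ (m : ℝ) →
          1 - 2 * Real.exp (-t ^ 2) ≤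
            P.real {ω | HasRIP (preconditioned (S ω) p F) T} := by
  -- `288 = 2 · 144`: the rate `1/(144μ²)`, doubled to absorb the prefactor.
  refine ⟨288, by norm_num, ?_⟩
  intro 𝕜 _ Ω _ P _ n m ℓ M hℓ hM F hF T hT p hpS hp S hS t ht hm
  have hp1 : ∑ j, p j = 1 := hpS.2
  have hn : 0 < n := by
    rcases Nat.eq_zero_or_pos n with rfl | h
    · simp at hp1
    · exact h
  have hℓ' : (1 : ℝ) ≤ ℓ := by exact_mod_cast hℓ
  have hM' : (1 : ℝ) ≤ M := by exact_mod_cast hM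
  -- For `t² < log 2` the claimed lower bound is nonpositive.
  rcases lt_or_ge (t ^ 2) (Real.log 2) with htl | htl
  · have h : (2 : ℝ)⁻¹ ≤ Real.exp (-t ^ 2) := by
      rw [← Real.exp_log (by norm_num : (0 : ℝ) < 2), ← Real.exp_neg]
      gcongr
    linarith [measureReal_nonneg (μ := P) (s := {ω | HasRIP (preconditioned (S ω) p F) T})]
  set μ := samplingComplexity (localCoherences F T) p with hμdef
  by_cases hμ : 0 < μ
  swap
  -- If `μ ≤ 0`, then `F` kills every unit vector of `T`; being unitary, it leaves none.
  · have hR (ω) : HasRIP (preconditioned (S ω) p F) T := by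
      intro u hu hu1
      have h0 (j) : F.mulVec u.ofLp j = 0 := by
        have h := norm_inner_rowVector_le (F := F) hp hu hu1.le j
        rw [inner_rowVector] at h
        exact norm_le_zero_iff.1 (h.trans
          (mul_nonpos_of_nonpos_of_nonneg (not_lt.1 hμ) (Real.sqrt_nonneg _)))
      have h := sum_norm_sq_mulVec hF u
      simp [h0, hu1] at h
    simp only [hR, Set.ofPred_true, probReal_univ]
    linarith [Real.exp_pos (-t ^ 2)]
  have hpos : 0 < Real.log ℓ + Real.log M + t ^ 2 := by
    have := Real.log_nonneg hℓ'
    have := Real.log_nonneg hM'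
    positivity
  have hm0 : 0 < m := by
    have : (0 : ℝ) < m := lt_of_lt_of_le (by positivity) hm
    exact_mod_cast this
  have hx : 2 * (Real.log ℓ + Real.log M + t ^ 2) ≤ m / (144 * μ ^ 2) := by
    rw [le_div_iff₀ (by positivity)]
    linarith
  set b := 2 * (2 * (ℓ : ℝ)) * Real.exp (-(m / (144 * μ ^ 2))) with hb
  have hfin {N : ℕ} (hN : N ≤ M) : 1 - 2 * Real.exp (-t ^ 2) ≤ 1 - N * b := by
    have := mul_exp_le_two_mul_exp hℓ' hM' (by exact_mod_cast hN : (N : ℝ) ≤ M) htl hx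
    linarith
  have hdim {d : ℕ} (hd : d ≤ 2 * ℓ) :
      2 * (d : ℝ) * Real.exp (-(m / (144 * μ ^ 2))) ≤ b := by
    have : (d : ℝ) ≤ 2 * ℓ := by exact_mod_cast hd
    rw [hb]
    gcongr
  rcases hT with ⟨I, hI, hU, hTU⟩ | ⟨T₀, ⟨I, hI, hU, hTU⟩, hT₀⟩
  · refine (hfin hI).trans ((measureReal_hasRIP_of_iUnion hn hm0 hp hp1 hS I
      (fun U => (U : Set (EuclideanSpace 𝕜 (Fin n)))) fun U hUI => ?_).trans_eq (by rw [hTU]))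
    obtain ⟨B, hBb, hB⟩ := exists_exceptional_tuples_submodule hF hp hp1 hμ U
      (by rw [hTU]; exact Set.subset_biUnion_of_mem hUI) m
    exact ⟨B, hBb.trans (hdim (Nat.mul_le_mul_left 2 (hU U hUI))), hB⟩
  · have hT' : T = ⋃ U ∈ I, realEmbed 𝕜 '' (U : Set (EuclideanSpace ℝ (Fin n))) := by
      rw [hT₀, hTU, Set.image_iUnion₂]
    refine (hfin hI).trans ((measureReal_hasRIP_of_iUnion hn hm0 hp hp1 hS I
      (fun U => realEmbed 𝕜 '' (U : Set (EuclideanSpace ℝ (Fin n))))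
      fun U hUI => ?_).trans_eq (by rw [hT']))
    obtain ⟨B, hBb, hB⟩ := exists_exceptional_tuples hF hp hp1 hμ
      (realEmbedLinear 𝕜 n ∘ₗ U.subtype) (fun u => norm_realEmbed u.1)
      (fun u : U => by rw [hT']; exact Set.mem_biUnion hUI ⟨u.1, u.2, rfl⟩) m
    refine ⟨B, hBb.trans (hdim ((hU U hUI).trans (by lia))), ?_⟩
    rintro J hJ _ ⟨u, hu, rfl⟩ hu1
    exact hB J hJ ⟨u, hu⟩ ((norm_realEmbed u).symm.trans hu1)
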